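/- Let $K=\mathbb F_q$ be a finite field of characteristic $p$, let $n$ be odd and prime to $p$, and let $L=\mathbb F_{q^n}$, with Galois group $G$ over $K$ generated by the Frobenius $\phi:x\mapsto x^q$ and trace $\mathrm{tr}=\mathrm{tr}_{L/K}$. Let $u\mapsto\bar u$ be the $K$-linear map of $K[G]$ with $\bar g=g^{-1}$ for $g\in G$, and for $u=\sum_g u_g g\in K[G]$, $x\in L$ put $u\circ x=\sum_g u_g\,g(x)$. Let $\alpha\in L$ generate a normal basis of $L/K$ and let $$R=\sum_{g\in G}\mathrm{tr}(\alpha g(\alpha))\,g\in K[G].$$ Let $\zeta$ be a primitive $n$-th root of unity in an extension field of $K$. On $\{0,\dots,n-1\}$ write $s\sim t$ if $s\equiv q^kt \pmod n$ for some $k\ge 0$ (and similarly for $n-s$, read modulo $n$), and let $S$ be a set of representatives of the classes of $\sim$. For $u=\sum_{i=0}^{n-1}u_i\phi^i\in K[G]$ put $u_s=\sum_i u_i\zeta^{si}\in K(\zeta^s)$. Then $u\mapsto (u_s)_{s\in S}$ is an isomorphism of $K$-algebras $$K[G]\to \prod_{s\in S}K(\zeta^s).$$ Let $J$ be the conjugation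 of the product obtained from $u\mapsto\bar u$ by this isomorphism, also written $v\mapsto\bar v$. Then $v\bar v=R$ can be solved class by class. 1. (Class of $0$.) With $v_0=\mathrm{tr}(\alpha)$ one has $v_0\overline{v_0}=R_0$ in the component $K(\zeta^0)=K$. 2. (Pairs.) Let $s,s'\in S$ with $s\not\sim n-s$ and $s'\sim n-s$. If $s'=n-s$, then $R_{s'}=R_s$; more generally, if $s'\equiv q^k(n-s)\pmod n$, then $R_{s'}=R_s^{q^k}$. The element $v_{s,s'}=(R_s,1)\in K(\zeta^s)\times K(\zeta^{s'})$, extended by $0$ in the other components, satisfies $v_{s,s'}\overline{v_{s,s'}}=(R_s,R_{s'})$. 3. (Self-reciprocal classes.) Let $s\in S$ with $s\ne 0$ and $s\sim n-s$. Then the component $K(\zeta^s)$ is stable under $J$, which induces a $K$-automorphism of it, with fixed field $K(\zeta^s)^J$; both $R_s$ and $-R_s$ are squares in $K(\zeta^s)$. Let $u^2=R_s$ and $u'^2=-R_s$ in $K(\zeta^s)$. - (a) If $u\in K(\zeta^s)^J$, then $v_s=u$ satisfies $v_s\overline{v_s}=R_s$. - (b) If $u'\notin K(\zeta^s)^J$,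 then $v_s=u'$ satisfies $v_s\overline{v_s}=R_s$. - (c) If $u\notin K(\zeta^s)^J$ and $u'\in K(\zeta^s)^J$, then there is an integer $N$ such that $-N$ is a non-zero square modulo $p$ and $-(N-1)$ is not a square modulo $p$. For every such $N$ there is an integer $\nu$ with $\nu^2\equiv N-1\pmod p$, and for all integers $\eta,\nu$ with $\eta^2\equiv -N$ and $\nu^2\equiv N-1\pmod p$, the element $v_s=(\nu u+u')/\eta$ satisfies $v_s\overline{v_s}=R_s$. 4. (Lifting.) There are families $(v_s)_{s\in S}$ obtained by choosing $v_0=\mathrm{tr}(\alpha)$; for each pair $\{s,s'\}$ as in 2, in one of its two orders, $v_s=R_s$ and $v_{s'}=1$; and for each $s$ as in 3 a value given by (a), (b) or (c). For every such family there is exactly one $v\in K[G]$ with components $v_s$ $(s\in S)$; it satisfies $v\bar v=R$, it is invertible, and $v^{-1}\circ\alpha$ generates a self-dual normal basis of $L/K$. Consequently, for every finite field $\mathbb F_q$ of characteristic $p$ and every odd $n$ prime to $p$, the equation $v\bar v=R$ has a solution in $\mathbb F_q[G]$ for every generator $\alpha$ of a normal basis, and $\mathbb F_{q^n}/\mathbb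 F_q$ has a self-dual normal basis. -/

import Mathlib

open scoped IntermediateField

noncomputable section

namespace SelfDualNormal

/-! ### Normal bases, the group algebra `K[G]` and the element `R` -/

section GroupAlgebra

variable (K L : Type*) [Field K] [Field L] [Algebra K L]

/-- `α` generates a normal basis of `L` over `K`: its conjugates form a `K`-basis of `L`. -/
def IsNormalGenerator (α : L) : Prop :=
  LinearIndependent K (fun g : Gal(L/K) => g α) ∧
    Submodule.span K (Set.range fun g : Gal(L/K) => g α) = ⊤

open Classical in
/-- `β` generates a self-dual normal basis: its conjugates form a basis which is its own dual
for the trace form. -/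
def IsSelfDualNormalGenerator (β : L) : Prop :=
  IsNormalGenerator K L β ∧
    ∀ g h : Gal(L/K), Algebra.trace K L (g β * h β) = if g = h then 1 else 0

variable {K L}

/-- Conjugation `u ↦ ū` on `K[G]`: the `K`-linear map sending each `g ∈ G` to `g⁻¹`. -/
def conj (u : MonoidAlgebra K Gal(L/K)) : MonoidAlgebra K Gal(L/K) :=
  MonoidAlgebra.mapDomain (fun g => g⁻¹) u

/-- The action `u ∘ x = ∑ u_g g(x)` of `K[G]` on `L`. -/
def act (u : MonoidAlgebra K Gal(L/K)) (x : L) : L :=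
  u.coeff.sum fun g c => c • g x

variable [FiniteDimensional K L]

/-- `R = ∑_{g ∈ G} tr(α g(α)) g`. -/
def R (α : L) : MonoidAlgebra K Gal(L/K) :=
  ∑ g : Gal(L/K), MonoidAlgebra.single g (Algebra.trace K L (α * g α))

end GroupAlgebra

/-! ### Cyclotomic classes -/

/-- The cyclotomic equivalence `s ∼ t`: `s ≡ q ^ k * t` modulo `n` for some `k`. -/
def CycEquiv (q n s t : ℕ) : Prop := ∃ k : ℕ, s ≡ q ^ k * t [MOD n]

/-- `S ⊆ {0, …, n - 1}` contains exactly one element of each cyclotomic class. -/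
def IsRepSet (q n : ℕ) (S : Finset ℕ) : Prop :=
  (∀ s ∈ S, s < n) ∧ ∀ t < n, ∃! s, s ∈ S ∧ CycEquiv q n s t

/-! ### The decomposition of `K[G]` into the fields `K(ζ ^ s)` -/

section Components

variable {K : Type*} (L : Type*) {E : Type*} [Field K] [Fintype K] [Field L] [Algebra K L]
  [FiniteDimensional K L] [Field E] [Algebra K E] (ζ : E) (S : Finset ℕ)

/-- The product `∏_{s ∈ S} K(ζ ^ s)`. -/
abbrev Components : Type _ := (s : S) → K⟮ζ ^ (s : ℕ)⟯

variable {L}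

/-- `u_s = u(ζ ^ s) = ∑_{i < n} u_i ζ ^ (s i)` in `K(ζ ^ s)`, for `u = ∑_{i < n} u_i φ ^ i` where
`φ` is the Frobenius `x ↦ x ^ q` and `n = [L : K]` is its order. -/
def evalAt (u : MonoidAlgebra K Gal(L/K)) (s : ℕ) : K⟮ζ ^ s⟯ :=
  ∑ i ∈ Finset.range (Module.finrank K L),
    algebraMap K K⟮ζ ^ s⟯ (u.coeff (FiniteField.frobeniusAlgEquivOfAlgebraic K L ^ i)) *
      IntermediateField.AdjoinSimple.gen K (ζ ^ s) ^ i

/-- The map `u ↦ (u_s)_{s ∈ S}` from `K[G]` to `∏_{s ∈ S} K(ζ ^ s)`. -/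
def evalMap (u : MonoidAlgebra K Gal(L/K)) : Components (K := K) ζ S :=
  fun s => evalAt ζ u (s : ℕ)

variable (L)

/-- Conjugation `J` on `∏_{s ∈ S} K(ζ ^ s)`, transported from `K[G]` along `evalMap`
(which is bijective when `S` represents the cyclotomic classes; this is part of the theorem). -/
def J (x : Components (K := K) ζ S) : Components (K := K) ζ S :=
  evalMap (L := L) ζ S (conj (Function.invFun (evalMap (L := L) ζ S) x))

variable {S}

/-- The map induced by `J` on the component `K(ζ ^ s)`. -/
def conjAt (s : S) (y : K⟮ζ ^ (s : ℕ)⟯) : K⟮ζ ^ (s : ℕ)⟯ :=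
  J L ζ S (Pi.single s y) s

end Components

/-! ### The recipe for a solution, class by class -/

/-- `-N` is a nonzero square modulo `p`, but `-(N - 1)` is not a square modulo `p`. -/
def IsGoodInt (p : ℕ) (N : ℤ) : Prop :=
  (∃ η : ℤ, ¬ (p : ℤ) ∣ η ∧ η ^ 2 ≡ -N [ZMOD p]) ∧ ¬ ∃ x : ℤ, x ^ 2 ≡ -(N - 1) [ZMOD p]

section Recipe

variable {K L E : Type*} [Field K] [Fintype K] [Field L] [Algebra K L]
  [FiniteDimensional K L] [Field E] [Algebra K E] (p : ℕ) (α : L) (ζ : E) {S : Finset ℕ}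

/-- The prescribed value `y` at a class `s ≠ 0` with `s ∼ n - s`: with `u`, `u'` square roots of
`R_s`, `-R_s`, it is `u` if `u` is fixed by conjugation, `u'` if `u'` is not fixed,
and `(ν u + u') / η` if `u` is not fixed and `u'` is fixed. -/
def IsSelfReciprocalChoice (s : S) (y : K⟮ζ ^ (s : ℕ)⟯) : Prop :=
  ∃ u u' : K⟮ζ ^ (s : ℕ)⟯,
    u ^ 2 = evalAt ζ (R (K := K) α) (s : ℕ) ∧ u' ^ 2 = -evalAt ζ (R (K := K) α) (s : ℕ) ∧
    ((conjAt L ζ s u = u ∧ y = u) ∨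
     (conjAt L ζ s u' ≠ u' ∧ y = u') ∨
     (conjAt L ζ s u ≠ u ∧ conjAt L ζ s u' = u' ∧
       ∃ N η ν : ℤ, IsGoodInt p N ∧ η ^ 2 ≡ -N [ZMOD p] ∧ ν ^ 2 ≡ N - 1 [ZMOD p] ∧
         y = ((ν : K⟮ζ ^ (s : ℕ)⟯) * u + (u' : K⟮ζ ^ (s : ℕ)⟯)) / (η : K⟮ζ ^ (s : ℕ)⟯)))

/-- The family `v = (v_s)_{s ∈ S}` follows the recipe: `tr(α)` at `0`; `R_s` and `1`
(in one of the two orders) at each pair `s`, `s'` of distinct opposite classes;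
one of the values of `IsSelfReciprocalChoice` at the other classes. -/
structure FollowsRecipe (n : ℕ) (v : Components (K := K) ζ S) : Prop where
  zero : ∀ s : S, (s : ℕ) = 0 → v s = algebraMap K K⟮ζ ^ (s : ℕ)⟯ (Algebra.trace K L α)
  pair : ∀ s s' : S, ¬ CycEquiv (Fintype.card K) n s (n - s) →
    CycEquiv (Fintype.card K) n s' (n - s) →
      (v s = evalAt ζ (R (K := K) α) (s : ℕ) ∧ v s' = 1) ∨
      (v s' = evalAt ζ (R (K := K) α) (s' : ℕ) ∧ v s = 1)
  selfReciprocal : ∀ s : S, (s : ℕ) ≠ 0 → CycEquiv (Fintype.card K) n s (n - s) →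
    IsSelfReciprocalChoice p α ζ s (v s)

end Recipe

end SelfDualNormal

end

open SelfDualNormal

/-! Pulled back along `u ↦ u ∘ α`, the trace form of `L` becomes the coefficient of `1` in `v̄ u R`
(`trace_act_mul_act`). If `w w̄ = R`, then `w` is invertible, since multiplication by `R` is
injective by nondegeneracy of the trace; for `β = w⁻¹ ∘ α` the trace of `g(β) h(β)` is the
coefficient of `1` in `h⁻¹ g`, so `β` is self-dual (`isSelfDualNormalGenerator_act`). Everything
reduces to solving `w w̄ = R`.

As `G` is generated by the Frobenius, evaluation at the `ζ ^ s` splits `K[G]` into fields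
(`evalMap_injective`, `evalMap_surjective`). Conjugation evaluates at `ζ ^ (-s)`: the coordinate of
`J y` at `s` is a `q ^ k`-th power of the coordinate of `y` at the class of `-s` (`coe_J_apply`).
Moreover `R̄ = R`.

At `0`, `J` is trivial and `R_0 = tr(α)²`. On a pair of opposite classes `J` exchanges two fields,
so `(R_s, 1)` has norm `(R_s, R_s')`. On a self-reciprocal class `s ≠ 0`, `J` is an involution,
nontrivial because `n` is odd. It fixes `R_s`, and elements of the fixed field become squares in a
quadratic extension of finite fields. A square root of a fixed element is either fixed or negated by
`J`, which settles (a) and (b); in (c), `-1` is not a square modulo `p`, and two consecutive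
residues, a nonzero square and then a nonsquare, correct the sign. -/

namespace SelfDualNormal

/-! ### Cyclotomic classes modulo `n` -/

section Cyc

lemma CycEquiv.trans {q n r s t : ℕ} (h : CycEquiv q n r s) (h' : CycEquiv q n s t) :
    CycEquiv q n r t := by
  obtain ⟨k, hk⟩ := h
  obtain ⟨l, hl⟩ := h'
  exact ⟨k + l, hk.trans (by rw [pow_add, mul_assoc]; exact hl.mul_left _)⟩

lemma CycEquiv.symm {q n s t : ℕ} (hq : q.Coprime n) (h : CycEquiv q n s t) :
    CycEquiv q n t s := by
  obtain ⟨k, hk⟩ := h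
  -- `q ^ (k φ(n) - k)` inverts `q ^ k` modulo `n`. The exponent is a multiple of `k` so that the
  -- subtraction does not truncate; this fails only for `n = 0`, where coprimality forces `q = 1`.
  have h1 : q ^ (k * n.totient) ≡ 1 [MOD n] := by
    rw [mul_comm, pow_mul]
    simpa using (Nat.ModEq.pow_totient hq).pow k
  have hle : k ≤ k * n.totient ∨ n = 0 := by
    rcases Nat.eq_zero_or_pos n with h0 | h0
    · exact Or.inr h0
    · exact Or.inl (Nat.le_mul_of_pos_right _ (Nat.totient_pos.2 h0))
  rcases hle with hle | rfl
  · refine ⟨k * n.totient - k, ?_⟩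
    calc t = 1 * t := (one_mul t).symm
      _ ≡ q ^ (k * n.totient) * t [MOD n] := h1.symm.mul_right t
      _ = q ^ (k * n.totient - k) * (q ^ k * t) := by
        rw [← mul_assoc, ← pow_add, Nat.sub_add_cancel hle]
      _ ≡ q ^ (k * n.totient - k) * s [MOD n] := hk.symm.mul_left _
  · rw [Nat.coprime_zero_right] at hq
    subst hq
    exact ⟨0, by simpa using hk.symm⟩

lemma CycEquiv.sub {q n s t : ℕ} (hs : s ≤ n) (ht : t ≤ n) (h : CycEquiv q n s t) :
    CycEquiv q n (n - s) (n - t) := by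
  obtain ⟨k, hk⟩ := h
  refine ⟨k, Nat.ModEq.add_right_cancel hk ?_⟩
  rw [Nat.sub_add_cancel hs, ← mul_add, Nat.sub_add_cancel ht]
  exact (Nat.modEq_zero_iff_dvd.2 dvd_rfl).trans (Nat.modEq_zero_iff_dvd.2 (dvd_mul_left n _)).symm

lemma CycEquiv.sub_left {q n s t : ℕ} (hs : s ≤ n) (ht : t ≤ n) (h : CycEquiv q n s (n - t)) :
    CycEquiv q n (n - s) t := by
  simpa [Nat.sub_sub_self ht] using h.sub hs (Nat.sub_le n t)

lemma CycEquiv.sub_comm {q n s t : ℕ} (hq : q.Coprime n) (hs : s ≤ n) (ht : t ≤ n)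
    (h : CycEquiv q n s (n - t)) : CycEquiv q n t (n - s) :=
  (h.sub_left hs ht).symm hq

lemma IsRepSet.eq {q n : ℕ} {S : Finset ℕ} (hS : IsRepSet q n S) {s t : ℕ}
    (hs : s ∈ S) (ht : t ∈ S) (h : CycEquiv q n s t) : s = t :=
  (hS.2 t (hS.1 t ht)).unique ⟨hs, h⟩ ⟨ht, 0, by simp [Nat.ModEq]⟩

lemma IsRepSet.exists_cycEquiv {q n : ℕ} {S : Finset ℕ} (hS : IsRepSet q n S) (hn : n ≠ 0) (t : ℕ) :
    ∃ s ∈ S, CycEquiv q n s t := by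
  obtain ⟨s, ⟨hs, k, hk⟩, -⟩ := hS.2 (t % n) (Nat.mod_lt _ (Nat.pos_of_ne_zero hn))
  exact ⟨s, hs, k, hk.trans ((Nat.mod_modEq t n).mul_left _)⟩

lemma exists_isRepSet {q n : ℕ} (hq : q.Coprime n) :
    ∃ S : Finset ℕ, IsRepSet q n S := by
  classical
  -- The least element of each class is taken as its representative.
  refine ⟨(Finset.range n).filter fun s => ∀ t < n, CycEquiv q n s t → s ≤ t, ?_, ?_⟩
  · intro s hs
    simpa using (Finset.mem_filter.1 hs).1
  · intro t ht
    have hex : ∃ s, s < n ∧ CycEquiv q n s t := ⟨t, ht, 0, by simp [Nat.ModEq]⟩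
    have hsp := Nat.find_spec hex
    refine ⟨Nat.find hex, ⟨?_, hsp.2⟩, ?_⟩
    · rw [Finset.mem_filter, Finset.mem_range]
      exact ⟨hsp.1, fun r hr h => Nat.find_min' hex ⟨hr, (h.symm hq).trans hsp.2⟩⟩
    · rintro s ⟨hs, hst⟩
      rw [Finset.mem_filter, Finset.mem_range] at hs
      exact le_antisymm (hs.2 _ hsp.1 (hst.trans (hsp.2.symm hq))) (Nat.find_min' hex ⟨hs.1, hst⟩)

lemma not_cycEquiv_sub {q n s t : ℕ} (hq : q.Coprime n) (hs : s ≤ n) (ht : t ≤ n)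
    (h : ¬ CycEquiv q n s (n - s)) (hst : CycEquiv q n t (n - s)) : ¬ CycEquiv q n t (n - t) :=
  fun h' => h (((hst.sub_left ht hs).symm hq).trans ((h'.symm hq).trans hst))

end Cyc

/-! ### The trace form on `K[G]` and self-dual generators -/

section GroupAlgebra

variable {K L : Type*} [Field K] [Field L] [Algebra K L]

lemma conj_single (g : Gal(L/K)) (c : K) :
    conj (MonoidAlgebra.single g c) = MonoidAlgebra.single g⁻¹ c :=
  MonoidAlgebra.mapDomain_single

lemma conj_add (u v : MonoidAlgebra K Gal(L/K)) : conj (u + v) = conj u + conj v :=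
  MonoidAlgebra.mapDomain_add _ _ _

lemma conj_zero : conj (0 : MonoidAlgebra K Gal(L/K)) = 0 :=
  MonoidAlgebra.mapDomain_zero _

lemma conj_conj (u : MonoidAlgebra K Gal(L/K)) : conj (conj u) = u := by
  induction u using MonoidAlgebra.induction_linear with
  | zero => rw [conj_zero, conj_zero]
  | add u v hu hv => rw [conj_add, conj_add, hu, hv]
  | single g c => rw [conj_single, conj_single, inv_inv]

lemma conj_mul (u v : MonoidAlgebra K Gal(L/K)) : conj (u * v) = conj v * conj u := by
  induction u using MonoidAlgebra.induction_linear with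
  | zero => simp [conj_zero]
  | add u u' hu hu' => simp [conj_add, add_mul, mul_add, hu, hu']
  | single g c =>
    induction v using MonoidAlgebra.induction_linear with
    | zero => simp [conj_zero]
    | add v v' hv hv' => simp [conj_add, add_mul, mul_add, hv, hv']
    | single h d => simp [conj_single, MonoidAlgebra.single_mul_single, mul_comm c d]

lemma conj_one : conj (1 : MonoidAlgebra K Gal(L/K)) = 1 := by
  rw [MonoidAlgebra.one_def, conj_single, inv_one]

lemma act_single (g : Gal(L/K)) (c : K) (x : L) : act (MonoidAlgebra.single g c) x = c • g x := by
  simp [act]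

lemma act_add (u v : MonoidAlgebra K Gal(L/K)) (x : L) : act (u + v) x = act u x + act v x := by
  classical
  rw [act, MonoidAlgebra.coeff_add, Finsupp.sum_add_index']
  · rfl
  · simp
  · simp [add_smul]

lemma act_zero (x : L) : act (0 : MonoidAlgebra K Gal(L/K)) x = 0 := by
  simp [act]

lemma apply_act (g : Gal(L/K)) (u : MonoidAlgebra K Gal(L/K)) (x : L) :
    g (act u x) = act (MonoidAlgebra.single g 1 * u) x := by
  induction u using MonoidAlgebra.induction_linear with
  | zero => rw [mul_zero, act_zero, map_zero]
  | add u v hu hv => rw [act_add, map_add, mul_add, act_add, hu, hv]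
  | single h c => rw [MonoidAlgebra.single_mul_single, act_single, act_single]; simp

variable [FiniteDimensional K L]

lemma act_eq_sum (u : MonoidAlgebra K Gal(L/K)) (x : L) :
    act u x = ∑ g : Gal(L/K), u.coeff g • g x :=
  Finsupp.sum_fintype _ _ (by simp)

lemma coeff_R (α : L) (g : Gal(L/K)) : (R (K := K) α).coeff g = Algebra.trace K L (α * g α) := by
  classical
  simp [R, MonoidAlgebra.coeff_sum, Finsupp.finsetSum_apply, Finsupp.single_apply]

lemma IsNormalGenerator.act_injective {α : L} (h : IsNormalGenerator K L α)
    {u : MonoidAlgebra K Gal(L/K)} (hu : act u α = 0) : u = 0 := by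
  rw [act_eq_sum] at hu
  ext g
  exact Fintype.linearIndependent_iff.1 h.1 _ hu g

lemma IsNormalGenerator.act_surjective {α : L} (h : IsNormalGenerator K L α) (y : L) :
    ∃ u : MonoidAlgebra K Gal(L/K), act u α = y := by
  obtain ⟨c, hc⟩ := (Submodule.mem_span_range_iff_exists_fun K).1
    (h.2 ▸ Submodule.mem_top : y ∈ Submodule.span K (Set.range fun g : Gal(L/K) => g α))
  refine ⟨.ofCoeff (Finsupp.equivFunOnFinite.symm c), ?_⟩
  rw [act_eq_sum, ← hc]
  rfl

/-- The trace is invariant under `g⁻¹`, which carries `α g(α)` to `g⁻¹(α) α`. -/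
lemma conj_R (α : L) : conj (R (K := K) α) = R α := by
  have h : ∀ g : Gal(L/K), Algebra.trace K L (α * g α) = Algebra.trace K L (α * g⁻¹ α) := by
    intro g
    rw [← Algebra.trace_eq_of_algEquiv g⁻¹, map_mul, mul_comm]
    congr 2
    exact g.symm_apply_apply α
  have hc : conj (R (K := K) α) =
      ∑ g : Gal(L/K), MonoidAlgebra.single g⁻¹ (Algebra.trace K L (α * g α)) := by
    simp only [conj, R]
    exact (map_sum (MonoidAlgebra.mapDomainAddEquiv K (Equiv.inv Gal(L/K))) _ _).trans
      (Finset.sum_congr rfl fun g _ => MonoidAlgebra.mapDomain_single)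
  rw [hc, R, ← Equiv.sum_comp (Equiv.inv Gal(L/K))]
  refine Finset.sum_congr rfl fun g _ => ?_
  simp only [Equiv.inv_apply, inv_inv]
  rw [h g]

/-- The trace form of `L`, pulled back to `K[G]` along `u ↦ u ∘ α`. -/
lemma trace_act_mul_act (α : L) (u v : MonoidAlgebra K Gal(L/K)) :
    Algebra.trace K L (act u α * act v α) = (conj v * u * R α).coeff 1 := by
  induction u using MonoidAlgebra.induction_linear with
  | zero => simp [act_zero]
  | add u u' hu hu' => simp [act_add, add_mul, mul_add, hu, hu']
  | single g c =>
    induction v using MonoidAlgebra.induction_linear with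
    | zero => simp [act_zero, conj_zero]
    | add v v' hv hv' => simp [act_add, conj_add, add_mul, mul_add, hv, hv']
    | single h d =>
      have hg : Algebra.trace K L (g α * h α) = Algebra.trace K L (α * (g⁻¹ * h) α) := by
        rw [← Algebra.trace_eq_of_algEquiv g⁻¹, map_mul]
        congr 2
        exact g.symm_apply_apply α
      rw [act_single, act_single, conj_single, MonoidAlgebra.single_mul_single,
        MonoidAlgebra.coeff_single_mul_apply, coeff_R, smul_mul_smul_comm, map_smul, hg]
      simp [mul_comm c d]

/-- If `u R = 0`, then `u ∘ α` is orthogonal to every `v ∘ α`, that is, to all of `L`. -/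
lemma IsNormalGenerator.mul_R_injective [Algebra.IsSeparable K L] {α : L}
    (h : IsNormalGenerator K L α) {u : MonoidAlgebra K Gal(L/K)} (hu : u * R α = 0) : u = 0 := by
  refine h.act_injective ((traceForm_nondegenerate K L).1 _ fun y => ?_)
  obtain ⟨v, rfl⟩ := h.act_surjective y
  rw [Algebra.traceForm_apply, trace_act_mul_act, mul_assoc, hu, mul_zero]
  rfl

/-- Since `w` divides `R`, multiplication by `w` is injective on a finite-dimensional space, hence
surjective. -/
lemma IsNormalGenerator.exists_inverse [Algebra.IsSeparable K L] {α : L}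
    (h : IsNormalGenerator K L α) (hc : ∀ u v : MonoidAlgebra K Gal(L/K), u * v = v * u)
    {w : MonoidAlgebra K Gal(L/K)} (hw : w * conj w = R α) : ∃ w', w * w' = 1 ∧ w' * w = 1 := by
  have hinj : Function.Injective (LinearMap.mulLeft K w) := by
    refine (injective_iff_map_eq_zero _).2 fun u hu => h.mul_R_injective ?_
    rw [← hw, ← mul_assoc, hc u w]
    rw [LinearMap.mulLeft_apply] at hu
    rw [hu, zero_mul]
  have : FiniteDimensional K (MonoidAlgebra K Gal(L/K)) :=
    Module.Finite.equiv (MonoidAlgebra.coeffLinearEquiv K).symm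
  obtain ⟨w', hw'⟩ := LinearMap.surjective_of_injective hinj 1
  exact ⟨w', hw', (hc _ _).trans hw'⟩

lemma isSelfDualNormalGenerator_act [IsGalois K L] {α : L}
    (hc : ∀ u v : MonoidAlgebra K Gal(L/K), u * v = v * u)
    {w w' : MonoidAlgebra K Gal(L/K)} (hw : w * conj w = R α) (h1 : w * w' = 1) :
    IsSelfDualNormalGenerator K L (act w' α) := by
  classical
  have key : ∀ g h : Gal(L/K),
      Algebra.trace K L (g (act w' α) * h (act w' α)) = if g = h then 1 else 0 := by
    intro g h
    have hconj : conj w' * conj w = 1 := by rw [← conj_mul, h1, conj_one]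
    rw [apply_act, apply_act, trace_act_mul_act, conj_mul, conj_single, ← hw]
    have : conj w' * MonoidAlgebra.single h⁻¹ (1 : K) * (MonoidAlgebra.single g 1 * w') *
        (w * conj w) = MonoidAlgebra.single (h⁻¹ * g) 1 := by
      calc _ = conj w' * (MonoidAlgebra.single h⁻¹ (1 : K) * MonoidAlgebra.single g 1) *
            (w' * w) * conj w := by simp only [mul_assoc]
        _ = _ := by
          rw [hc w' w, h1, mul_one, hc (conj w'), mul_assoc, hconj, mul_one,
            MonoidAlgebra.single_mul_single, one_mul]
    rw [this, MonoidAlgebra.coeff_single, Finsupp.single_apply, inv_mul_eq_one]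
    simp only [eq_comm]
  have hli : LinearIndependent K fun g : Gal(L/K) => g (act w' α) := by
    -- Orthonormality gives independence: pairing a relation with the `h`-conjugate isolates its
    -- coefficient at `h`.
    refine Fintype.linearIndependent_iff.2 fun c hcz h => ?_
    have := congrArg (fun y => Algebra.trace K L (y * h (act w' α))) hcz
    simpa [Finset.sum_mul, key] using this
  refine ⟨⟨hli, ?_⟩, fun g h => (key g h).trans (by congr)⟩
  refine hli.span_eq_top_of_card_eq_finrank' ?_
  rw [Fintype.card_eq_nat_card]
  exact IsGalois.card_aut_eq_finrank K L

lemma exists_isNormalGenerator [IsGalois K L] : ∃ α : L, IsNormalGenerator K L α := by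
  obtain ⟨α, hα⟩ := exists_linearIndependent_algEquiv_apply K L
  refine ⟨α, hα, hα.span_eq_top_of_card_eq_finrank' ?_⟩
  rw [Fintype.card_eq_nat_card]
  exact IsGalois.card_aut_eq_finrank K L

end GroupAlgebra

/-! ### Evaluation of `K[G]` at roots of unity -/

section Evaluation

variable {K L F : Type*} [Field K] [Fintype K] [Field L] [Algebra K L] [FiniteDimensional K L]
  [Field F] [Algebra K F]

lemma orderOf_frobenius :
    orderOf (FiniteField.frobeniusAlgEquivOfAlgebraic K L) = Module.finrank K L := by
  have := Module.finite_of_finite K (M := L)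
  exact FiniteField.orderOf_frobeniusAlgEquivOfAlgebraic K L

lemma bijective_frobenius_pow : Function.Bijective fun i : Fin (Module.finrank K L) =>
    FiniteField.frobeniusAlgEquivOfAlgebraic K L ^ (i : ℕ) := by
  have := Module.finite_of_finite K (M := L)
  exact FiniteField.bijective_frobeniusAlgEquivOfAlgebraic_pow K L

lemma exists_eq_frobenius_pow (g : Gal(L/K)) :
    ∃ i : ℕ, g = FiniteField.frobeniusAlgEquivOfAlgebraic K L ^ i :=
  let ⟨i, hi⟩ := bijective_frobenius_pow.2 g
  ⟨i, hi.symm⟩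

lemma mem_zpowers_frobenius (g : Gal(L/K)) :
    g ∈ Subgroup.zpowers (FiniteField.frobeniusAlgEquivOfAlgebraic K L) :=
  let ⟨i, hi⟩ := exists_eq_frobenius_pow g
  ⟨i, by rw [hi]; simp⟩

lemma groupAlgebra_mul_comm (u v : MonoidAlgebra K Gal(L/K)) : u * v = v * u := by
  induction u using MonoidAlgebra.induction_linear with
  | zero => simp
  | add u u' hu hu' => rw [add_mul, mul_add, hu, hu']
  | single g c =>
    induction v using MonoidAlgebra.induction_linear with
    | zero => simp
    | add v v' hv hv' => rw [mul_add, add_mul, hv, hv']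
    | single h d =>
      obtain ⟨i, rfl⟩ := exists_eq_frobenius_pow g
      obtain ⟨j, rfl⟩ := exists_eq_frobenius_pow h
      rw [MonoidAlgebra.single_mul_single, MonoidAlgebra.single_mul_single, ← pow_add, ← pow_add,
        add_comm, mul_comm c]

/-- Evaluation of an element of `K[G]`, read as a polynomial in the Frobenius, at `x`. -/
noncomputable def evalHom (x : F) (hx : x ^ Module.finrank K L = 1) :
    MonoidAlgebra K Gal(L/K) →ₐ[K] F :=
  MonoidAlgebra.lift K F Gal(L/K) ((Units.coeHom F).comp
    (monoidHomOfForallMemZpowers (g := FiniteField.frobeniusAlgEquivOfAlgebraic K L)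
      mem_zpowers_frobenius
      (g' := Units.ofPowEqOne x _ hx Module.finrank_pos.ne')
      ((orderOf_dvd_of_pow_eq_one (Units.pow_ofPowEqOne hx Module.finrank_pos.ne')).trans
        orderOf_frobenius.symm.dvd)))

lemma evalHom_single_pow (x : F) (hx : x ^ Module.finrank K L = 1) (i : ℕ) (c : K) :
    evalHom x hx (MonoidAlgebra.single (FiniteField.frobeniusAlgEquivOfAlgebraic K L ^ i) c) =
      algebraMap K F c * x ^ i := by
  rw [evalHom, MonoidAlgebra.lift_single, MonoidHom.comp_apply, map_pow,
    monoidHomOfForallMemZpowers_apply_gen, map_pow, Algebra.smul_def]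
  simp

lemma eq_sum_single (u : MonoidAlgebra K Gal(L/K)) :
    u = ∑ i ∈ Finset.range (Module.finrank K L),
      MonoidAlgebra.single (FiniteField.frobeniusAlgEquivOfAlgebraic K L ^ i)
        (u.coeff (FiniteField.frobeniusAlgEquivOfAlgebraic K L ^ i)) := by
  classical
  rw [Finset.sum_range (fun i => MonoidAlgebra.single
    (FiniteField.frobeniusAlgEquivOfAlgebraic K L ^ i)
        (u.coeff (FiniteField.frobeniusAlgEquivOfAlgebraic K L ^ i))),
    bijective_frobenius_pow.sum_comp fun g => MonoidAlgebra.single g (u.coeff g)]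
  ext g
  simp

lemma evalHom_eq_sum (x : F) (hx : x ^ Module.finrank K L = 1) (u : MonoidAlgebra K Gal(L/K)) :
    evalHom x hx u = ∑ i ∈ Finset.range (Module.finrank K L),
      algebraMap K F (u.coeff (FiniteField.frobeniusAlgEquivOfAlgebraic K L ^ i)) * x ^ i := by
  conv_lhs => rw [eq_sum_single u]
  rw [map_sum]
  exact Finset.sum_congr rfl fun i _ => evalHom_single_pow x hx i _

lemma map_evalHom {F' : Type*} [Field F'] [Algebra K F'] (f : F →ₐ[K] F') (x : F)
    (hx : x ^ Module.finrank K L = 1) (y : F') (hy : y ^ Module.finrank K L = 1) (h : f x = y)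
    (u : MonoidAlgebra K Gal(L/K)) : f (evalHom x hx u) = evalHom y hy u := by
  rw [evalHom_eq_sum, evalHom_eq_sum, map_sum]
  refine Finset.sum_congr rfl fun i _ => ?_
  rw [map_mul f, f.commutes, map_pow f, h]

lemma evalHom_conj (x y : F) (hx : x ^ Module.finrank K L = 1) (hy : y ^ Module.finrank K L = 1)
    (hxy : x * y = 1) (u : MonoidAlgebra K Gal(L/K)) :
    evalHom x hx (conj u) = evalHom y hy u := by
  induction u using MonoidAlgebra.induction_linear with
  | zero => rw [conj_zero, map_zero, map_zero]
  | add u u' hu hu' => rw [conj_add, map_add, map_add, hu, hu']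
  | single g c =>
    obtain ⟨⟨i, hi⟩, rfl⟩ := bijective_frobenius_pow.2 g
    have hinv : (FiniteField.frobeniusAlgEquivOfAlgebraic K L ^ i)⁻¹ =
        FiniteField.frobeniusAlgEquivOfAlgebraic K L ^ (Module.finrank K L - i) := by
      rw [inv_eq_iff_mul_eq_one, ← pow_add, Nat.add_sub_cancel' hi.le, ← orderOf_frobenius,
        pow_orderOf_eq_one]
    dsimp only
    rw [conj_single, hinv, evalHom_single_pow, evalHom_single_pow]
    have h1 : x ^ (Module.finrank K L - i) * x ^ i = 1 := by
      rw [← pow_add, Nat.sub_add_cancel hi.le, hx]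
    have h2 : y ^ i = x ^ (Module.finrank K L - i) := by
      rw [← mul_one (x ^ _), ← one_pow i, ← hxy, mul_pow, ← mul_assoc, h1, one_mul]
    rw [h2]

/-- The map `z ↦ z ^ q ^ k` is a `K`-algebra endomorphism, so it commutes with evaluation. -/
lemma evalHom_pow_card_pow (x : F) (hx : x ^ Module.finrank K L = 1) (k : ℕ) (y : F)
    (hy : y ^ Module.finrank K L = 1) (h : y = x ^ Fintype.card K ^ k)
    (u : MonoidAlgebra K Gal(L/K)) : evalHom y hy u = evalHom x hx u ^ Fintype.card K ^ k := by
  have hf : ∀ z : F, (FiniteField.frobeniusAlgHom K F ^ k) z = z ^ Fintype.card K ^ k := by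
    intro z
    rw [AlgHom.coe_pow, FiniteField.coe_frobeniusAlgHom, pow_iterate]
  rw [← hf, map_evalHom _ x hx y hy]
  rw [hf, h]

end Evaluation

/-! ### Powers of an `n`-th root of unity -/

section RootsOfUnity

variable {K L E : Type*} [Field K] [Field L] [Algebra K L] [Field E] {ζ : E}

lemma pow_pow_finrank (hζ : ζ ^ Module.finrank K L = 1) (s : ℕ) :
    (ζ ^ s) ^ Module.finrank K L = 1 := by
  rw [← pow_mul, mul_comm, pow_mul, hζ, one_pow]

lemma gen_pow_finrank [Algebra K E] (hζ : ζ ^ Module.finrank K L = 1) (s : ℕ) :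
    IntermediateField.AdjoinSimple.gen K (ζ ^ s) ^ Module.finrank K L = 1 :=
  Subtype.ext (pow_pow_finrank hζ s)

lemma pow_eq_pow_of_modEq [FiniteDimensional K L] (hζ : ζ ^ Module.finrank K L = 1) {s t : ℕ}
    (h : s ≡ t [MOD Module.finrank K L]) : ζ ^ s = ζ ^ t :=
  (isOfFinOrder_iff_pow_eq_one.2 ⟨_, Module.finrank_pos, hζ⟩).pow_eq_pow_iff_modEq.2
    (h.of_dvd (orderOf_dvd_of_pow_eq_one hζ))

lemma finiteDimensional_component [Algebra K E] [FiniteDimensional K L]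
    (hζ : ζ ^ Module.finrank K L = 1) (s : ℕ) :
    FiniteDimensional K K⟮ζ ^ s⟯ :=
  IntermediateField.adjoin.finiteDimensional ((IsIntegral.of_pow Module.finrank_pos
    (by rw [hζ]; exact isIntegral_one)).pow s)

end RootsOfUnity

/-! ### The decomposition of `K[G]` -/

section Components

variable {K L E : Type*} [Field K] [Fintype K] [Field L] [Algebra K L] [FiniteDimensional K L]
  [Field E] [Algebra K E] {ζ : E}

lemma evalAt_eq_evalHom (hζ : ζ ^ Module.finrank K L = 1) (s : ℕ)
    (u : MonoidAlgebra K Gal(L/K)) :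
    evalAt ζ u s = evalHom _ (gen_pow_finrank hζ s) u :=
  (evalHom_eq_sum _ _ u).symm

/-- The fields `K(ζ ^ s)` are different types for different `s`; components are compared inside `E`.
-/
lemma coe_evalAt (hζ : ζ ^ Module.finrank K L = 1) (s : ℕ) (u : MonoidAlgebra K Gal(L/K)) :
    (evalAt ζ u s : E) = evalHom (ζ ^ s) (pow_pow_finrank hζ s) u := by
  rw [evalAt_eq_evalHom hζ]
  exact map_evalHom (IntermediateField.val K⟮ζ ^ s⟯) _ _ _ _ rfl u

lemma coe_evalAt_of_modEq (hζ : ζ ^ Module.finrank K L = 1) {s t k : ℕ}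
    (h : s ≡ Fintype.card K ^ k * t [MOD Module.finrank K L]) (u : MonoidAlgebra K Gal(L/K)) :
    (evalAt ζ u s : E) = (evalAt ζ u t : E) ^ Fintype.card K ^ k := by
  rw [coe_evalAt hζ, coe_evalAt hζ]
  refine evalHom_pow_card_pow _ _ _ _ _ ?_ u
  rw [pow_eq_pow_of_modEq hζ h, mul_comm, pow_mul]

lemma coe_evalAt_conj (hζ : ζ ^ Module.finrank K L = 1) {s : ℕ} (hs : s ≤ Module.finrank K L)
    (u : MonoidAlgebra K Gal(L/K)) :
    (evalAt ζ (conj u) s : E) = evalAt ζ u (Module.finrank K L - s) := by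
  rw [coe_evalAt hζ, coe_evalAt hζ]
  refine evalHom_conj _ _ _ _ ?_ u
  rw [← pow_add, Nat.add_sub_cancel' hs, hζ]

/-- The polynomial `∑ u_i X ^ i` has degree less than `n` and the `n` distinct roots `ζ ^ t`. -/
lemma eq_zero_of_evalAt (hζ : IsPrimitiveRoot ζ (Module.finrank K L))
    (u : MonoidAlgebra K Gal(L/K)) (h : ∀ t < Module.finrank K L, (evalAt ζ u t : E) = 0) :
    u = 0 := by
  classical
  let P : Polynomial E := ∑ i ∈ Finset.range (Module.finrank K L), Polynomial.monomial i
    (algebraMap K E (u.coeff (FiniteField.frobeniusAlgEquivOfAlgebraic K L ^ i)))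
  have hdeg : P.degree < Module.finrank K L := by
    refine (Polynomial.degree_sum_le _ _).trans_lt ((Finset.sup_lt_iff ?_).2 fun i hi => ?_)
    · exact WithBot.bot_lt_coe _
    · exact (Polynomial.degree_monomial_le _ _).trans_lt
        (Nat.cast_lt.2 (Finset.mem_range.1 hi))
  have hP : P = 0 := by
    refine Polynomial.eq_zero_of_degree_lt_of_eval_index_eq_zero
      (s := Finset.range (Module.finrank K L)) (v := fun t => ζ ^ t) ?_ (by simpa using hdeg) ?_
    · intro i hi j hj hij
      exact hζ.pow_inj (by simpa using hi) (by simpa using hj) hij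
    · intro t ht
      rw [Polynomial.eval_finsetSum, ← h t (Finset.mem_range.1 ht), coe_evalAt hζ.pow_eq_one,
        evalHom_eq_sum]
      simp
  ext g
  obtain ⟨⟨i, hi⟩, rfl⟩ := bijective_frobenius_pow.2 g
  have := congrArg (fun Q => Q.coeff i) hP
  simpa [P, Polynomial.finsetSum_coeff, Polynomial.coeff_monomial, hi] using this

lemma evalMap_injective (hζ : IsPrimitiveRoot ζ (Module.finrank K L)) {S : Finset ℕ}
    (hS : IsRepSet (Fintype.card K) (Module.finrank K L) S)
    (hq : (Fintype.card K).Coprime (Module.finrank K L))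
    {u v : MonoidAlgebra K Gal(L/K)} (h : evalMap ζ S u = evalMap ζ S v) : u = v := by
  rw [← sub_eq_zero]
  refine eq_zero_of_evalAt hζ _ fun t _ => ?_
  obtain ⟨s, hs, hst⟩ := hS.exists_cycEquiv Module.finrank_pos.ne' t
  obtain ⟨k, hk⟩ := hst.symm hq
  rw [coe_evalAt_of_modEq hζ.pow_eq_one hk, evalAt_eq_evalHom hζ.pow_eq_one, map_sub,
    ← evalAt_eq_evalHom hζ.pow_eq_one, ← evalAt_eq_evalHom hζ.pow_eq_one,
    show evalAt ζ u s = evalAt ζ v s from congrFun h ⟨s, hs⟩]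
  simp [Fintype.card_ne_zero]

/-- Irreducible polynomials that are not coprime agree here, so `ζ ^ s` and `ζ ^ t` are conjugate
over `K`. The Galois group of `K(ζ)` consists of Frobenius powers, which makes `s` and `t`
equivalent. -/
lemma isCoprime_minpoly (hζ : IsPrimitiveRoot ζ (Module.finrank K L)) {s t : ℕ}
    (h : ¬ CycEquiv (Fintype.card K) (Module.finrank K L) s t) :
    IsCoprime (minpoly K (ζ ^ s)) (minpoly K (ζ ^ t)) := by
  have hint : IsIntegral K ζ := IsIntegral.of_pow Module.finrank_pos
    (by rw [hζ.pow_eq_one]; exact isIntegral_one)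
  have : FiniteDimensional K K⟮ζ⟯ := IntermediateField.adjoin.finiteDimensional hint
  have : Finite K⟮ζ⟯ := Module.finite_of_finite K
  rw [(minpoly.irreducible (hint.pow s)).coprime_iff_not_dvd]
  intro hdvd
  have heq : minpoly K (ζ ^ t) = minpoly K (ζ ^ s) :=
    (minpoly.eq_of_irreducible_of_monic (minpoly.irreducible (hint.pow t))
      (Polynomial.aeval_eq_zero_of_dvd_aeval_eq_zero hdvd (minpoly.aeval _ _))
      (minpoly.monic (hint.pow t)))
  let z : K⟮ζ⟯ := IntermediateField.AdjoinSimple.gen K ζ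
  have hz : ∀ r, algebraMap K⟮ζ⟯ E (z ^ r) = ζ ^ r := fun r => rfl
  have hconj : IsConjRoot K (z ^ s) (z ^ t) := by
    rw [IsConjRoot, ← minpoly.algebraMap_eq (algebraMap K⟮ζ⟯ E).injective, hz,
      ← minpoly.algebraMap_eq (algebraMap K⟮ζ⟯ E).injective, hz, heq]
  obtain ⟨σ, hσ⟩ := isConjRoot_iff_exists_algEquiv.1 hconj
  obtain ⟨k, rfl⟩ := exists_eq_frobenius_pow σ
  refine h ⟨k, ?_⟩
  have := congrArg (algebraMap K⟮ζ⟯ E) hσ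
  rw [AlgEquiv.coe_pow, FiniteField.coe_frobeniusAlgEquivOfAlgebraic, pow_iterate, map_pow, hz,
    hz, ← pow_mul, mul_comm,
    (isOfFinOrder_iff_pow_eq_one.2 ⟨_, Module.finrank_pos, hζ.pow_eq_one⟩).pow_eq_pow_iff_modEq,
    ← hζ.eq_orderOf] at this
  exact this.symm

/-- Chinese remainder theorem: polynomials representing the `y s` are glued modulo the coprime
minimal polynomials, and the result is evaluated at the Frobenius in `K[G]`. -/
lemma evalMap_surjective (hζ : IsPrimitiveRoot ζ (Module.finrank K L)) {S : Finset ℕ}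
    (hS : IsRepSet (Fintype.card K) (Module.finrank K L) S) (y : Components (K := K) ζ S) :
    ∃ u : MonoidAlgebra K Gal(L/K), evalMap ζ S u = y := by
  have hint : ∀ s : ℕ, IsIntegral K (ζ ^ s) := fun s => (IsIntegral.of_pow Module.finrank_pos
    (by rw [hζ.pow_eq_one]; exact isIntegral_one)).pow s
  have hex : ∀ s : S, ∃ f : Polynomial K, Polynomial.aeval (ζ ^ (s : ℕ)) f = (y s : E) := by
    intro s
    obtain ⟨f, hf⟩ := (IntermediateField.adjoin.powerBasis (hint s)).exists_eq_aeval' (y s)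
    refine ⟨f, ?_⟩
    rw [hf]
    exact (Polynomial.aeval_algHom_apply (IntermediateField.val K⟮ζ ^ (s : ℕ)⟯)
      (IntermediateField.AdjoinSimple.gen K (ζ ^ (s : ℕ))) f)
  choose f hf using hex
  obtain ⟨g, hg⟩ := Ideal.pi_quotient_surjective
    (I := fun s : S => Ideal.span {minpoly K (ζ ^ (s : ℕ))})
    (fun s t hst => (Ideal.isCoprime_span_singleton_iff _ _).2 (isCoprime_minpoly hζ fun h =>
      hst (Subtype.ext (hS.eq s.2 t.2 h)))) fun s => Ideal.Quotient.mk _ (f s)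
  refine ⟨Polynomial.aeval
    (MonoidAlgebra.single (FiniteField.frobeniusAlgEquivOfAlgebraic K L) (1 : K)) g,
    funext fun s => Subtype.ext ?_⟩
  have h1 := evalHom_single_pow (ζ ^ (s : ℕ)) (pow_pow_finrank hζ.pow_eq_one s) 1 (1 : K)
  rw [pow_one, map_one, one_mul, pow_one] at h1
  rw [evalMap, coe_evalAt hζ.pow_eq_one, ← Polynomial.aeval_algHom_apply, h1, ← hf, ← sub_eq_zero,
    ← map_sub]
  have := Ideal.mem_span_singleton.1 (Ideal.Quotient.eq.1 (hg s))
  exact Polynomial.aeval_eq_zero_of_dvd_aeval_eq_zero this (minpoly.aeval _ _)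

/-- The decomposition `K[G] ≃ ∏ K(ζ ^ s)`. -/
noncomputable def evalEquiv (hζ : IsPrimitiveRoot ζ (Module.finrank K L)) {S : Finset ℕ}
    (hS : IsRepSet (Fintype.card K) (Module.finrank K L) S)
    (hq : (Fintype.card K).Coprime (Module.finrank K L)) :
    MonoidAlgebra K Gal(L/K) ≃ₐ[K] Components (K := K) ζ S :=
  AlgEquiv.ofBijective
    (AlgHom.pi fun s : S => evalHom _ (gen_pow_finrank hζ.pow_eq_one s))
    ⟨fun u v h => evalMap_injective hζ hS hq (funext fun s => by
        simpa [evalMap, evalAt_eq_evalHom hζ.pow_eq_one] using congrFun h s),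
      fun y => by
        obtain ⟨u, hu⟩ := evalMap_surjective (L := L) hζ hS y
        refine ⟨u, ?_⟩
        rw [← hu]
        exact funext fun s => (evalAt_eq_evalHom hζ.pow_eq_one s u).symm⟩

lemma evalEquiv_apply (hζ : IsPrimitiveRoot ζ (Module.finrank K L)) {S : Finset ℕ}
    (hS : IsRepSet (Fintype.card K) (Module.finrank K L) S)
    (hq : (Fintype.card K).Coprime (Module.finrank K L)) (u : MonoidAlgebra K Gal(L/K)) :
    evalEquiv hζ hS hq u = evalMap ζ S u :=
  funext fun s => (evalAt_eq_evalHom hζ.pow_eq_one s u).symm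

lemma J_evalMap (hζ : IsPrimitiveRoot ζ (Module.finrank K L)) {S : Finset ℕ}
    (hS : IsRepSet (Fintype.card K) (Module.finrank K L) S)
    (hq : (Fintype.card K).Coprime (Module.finrank K L)) (u : MonoidAlgebra K Gal(L/K)) :
    J L ζ S (evalMap ζ S u) = evalMap ζ S (conj u) := by
  rw [J, Function.leftInverse_invFun fun u v h => evalMap_injective hζ hS hq h]

end Components

/-! ### Squares in quadratic extensions of finite fields -/

section Squares

lemma isSquare_algebraMap_of_finrank_eq_two {F M : Type*} [Field F] [Field M] [Finite M]
    [Algebra F M] (h : Module.finrank F M = 2) (a : F) : IsSquare (algebraMap F M a) := by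
  have : Finite F := Finite.of_injective _ (algebraMap F M).injective
  have := Fintype.ofFinite F
  have := Fintype.ofFinite M
  by_cases h2 : ringChar M = 2
  · exact FiniteField.isSquare_of_char_two h2 _
  by_cases ha : a = 0
  · rw [ha, map_zero]
    exact IsSquare.zero
  rw [FiniteField.isSquare_iff h2 (by simpa using ha), ← map_pow]
  have hodd : Fintype.card F % 2 = 1 := FiniteField.odd_card_of_char_ne_two
    (by rwa [Algebra.ringChar_eq F M])
  obtain ⟨c, hc⟩ : ∃ c, Fintype.card F = 2 * c + 1 := ⟨Fintype.card F / 2, by omega⟩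
  have hM : Fintype.card M / 2 = (Fintype.card F - 1) * (c + 1) := by
    rw [Module.card_eq_pow_finrank (K := F), h, hc]
    have : (2 * c + 1) ^ 2 = 2 * (2 * c * (c + 1)) + 1 := by ring
    simp only [add_tsub_cancel_right]
    omega
  rw [hM, pow_mul, FiniteField.pow_card_sub_one_eq_one a ha, one_pow, map_one]

lemma mem_fixedField_zpowers {K M : Type*} [Field K] [Field M] [Algebra K M] (τ : M ≃ₐ[K] M)
    (a : M) : a ∈ IntermediateField.fixedField (Subgroup.zpowers τ) ↔ τ a = a := by
  rw [IntermediateField.mem_fixedField_iff]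
  refine ⟨fun h => h τ (Subgroup.mem_zpowers τ), fun ha σ hσ => ?_⟩
  have : Subgroup.zpowers τ ≤ MulAction.stabilizer Gal(M/K) a := by
    rw [Subgroup.zpowers_le]
    exact ha
  exact this hσ

lemma isSquare_of_involution {K M : Type*} [Field K] [Field M] [Finite M] [Algebra K M]
    [FiniteDimensional K M] {τ : M ≃ₐ[K] M} (hτ : τ ≠ 1) (hτ2 : τ * τ = 1) {a : M}
    (ha : τ a = a) : IsSquare a := by
  refine isSquare_algebraMap_of_finrank_eq_two (F := IntermediateField.fixedField
    (Subgroup.zpowers τ)) ?_ ⟨a, (mem_fixedField_zpowers τ a).2 ha⟩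
  rw [IntermediateField.finrank_fixedField_eq_card, Nat.card_zpowers]
  exact orderOf_eq_prime (by rw [pow_two, hτ2]) hτ

end Squares

/-! ### Consecutive residues modulo `p` -/

section GoodInt

lemma exists_int_sq_iff {p : ℕ} (a : ℤ) :
    (∃ x : ℤ, x ^ 2 ≡ a [ZMOD p]) ↔ IsSquare (a : ZMod p) := by
  constructor
  · rintro ⟨x, hx⟩
    refine ⟨(x : ZMod p), ?_⟩
    rw [← (ZMod.intCast_eq_intCast_iff _ _ _).2 hx, Int.cast_pow, pow_two]
  · rintro ⟨y, hy⟩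
    obtain ⟨x, rfl⟩ := ZMod.intCast_surjective y
    refine ⟨x, (ZMod.intCast_eq_intCast_iff _ _ _).1 ?_⟩
    rw [hy, Int.cast_pow, pow_two]

/-- With `m` the least nonsquare among the naturals, `m - 1` is a nonzero square modulo `p`, and `N
= 1 - m` works. -/
lemma exists_isGoodInt {p : ℕ} (hp : p.Prime) (h : ¬ ∃ x : ℤ, x ^ 2 ≡ -1 [ZMOD p]) :
    ∃ N : ℤ, IsGoodInt p N := by
  classical
  have hex : ∃ m : ℕ, ¬ ∃ x : ℤ, x ^ 2 ≡ m [ZMOD p] := by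
    -- A nonsquare exists because `p - 1 ≡ -1`.
    refine ⟨p - 1, fun ⟨x, hx⟩ => h ⟨x, hx.trans ?_⟩⟩
    rw [Nat.cast_sub hp.one_le]
    exact (Int.modEq_iff_dvd.2 ⟨-1, by push_cast; ring⟩)
  obtain ⟨m, hm⟩ : ∃ m, Nat.find hex = m := ⟨_, rfl⟩
  have hm1 := Nat.find_spec hex
  have hm2 : ∀ k < m, ∃ x : ℤ, x ^ 2 ≡ k [ZMOD p] := fun k hk =>
    not_not.1 (Nat.find_min hex (hm ▸ hk))
  rw [hm] at hm1
  have hmp : m < p := by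
    by_contra hle
    obtain ⟨x, hx⟩ := hm2 (m - p) (by have := hp.pos; omega)
    refine hm1 ⟨x, hx.trans (Int.modEq_iff_dvd.2 ⟨1, ?_⟩)⟩
    rw [Nat.cast_sub (not_lt.1 hle)]
    ring
  have h0 : m ≠ 0 := by
    rintro rfl
    exact hm1 ⟨0, by simp⟩
  have h1 : m ≠ 1 := by
    rintro rfl
    exact hm1 ⟨1, by simp⟩
  obtain ⟨η, hη⟩ := hm2 (m - 1) (by omega)
  rw [Nat.cast_sub (by omega)] at hη
  refine ⟨1 - m, ⟨η, fun hd => ?_, by simpa using hη⟩, fun ⟨x, hx⟩ => hm1 ⟨x, by simpa using hx⟩⟩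
  have hd2 : (p : ℤ) ∣ (m : ℤ) - 1 := by
    have := hη.dvd
    exact (dvd_sub_left (dvd_pow hd two_ne_zero)).1 (by simpa using this)
  have := Int.le_of_dvd (by omega) hd2
  omega

/-- `N - 1` is the product of the nonsquares `-1` and `-(N - 1)`. -/
lemma IsGoodInt.exists_sq {p : ℕ} (hp : p.Prime) (h : ¬ ∃ x : ℤ, x ^ 2 ≡ -1 [ZMOD p]) {N : ℤ}
    (hN : IsGoodInt p N) : ∃ ν : ℤ, ν ^ 2 ≡ N - 1 [ZMOD p] := by
  have := Fact.mk hp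
  have h2 := hN.2
  rw [exists_int_sq_iff] at h h2 ⊢
  rw [← legendreSym.eq_neg_one_iff] at h h2
  have h1 : legendreSym p (N - 1) = 1 := by
    rw [show N - 1 = -1 * -(N - 1) by ring, legendreSym.mul, h, h2]
    norm_num
  refine (legendreSym.eq_one_iff p fun h0 => ?_).1 h1
  rw [(legendreSym.eq_zero_iff p _).2 h0] at h1
  exact zero_ne_one h1

lemma IsGoodInt.cast_ne_zero {p : ℕ} {M : Type*} [Field M] [CharP M p] {N : ℤ}
    (hN : IsGoodInt p N) : (N : M) ≠ 0 := by
  obtain ⟨η, hη, hηN⟩ := hN.1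
  have h := (CharP.intCast_eq_intCast M p).2 hηN
  intro h0
  rw [Int.cast_neg, h0, neg_zero, Int.cast_pow] at h
  exact hη ((CharP.intCast_eq_zero_iff M p η).1 (pow_eq_zero_iff two_ne_zero |>.1 h))

end GoodInt

/-! ### Norm identities for cases (a), (b), (c) -/

section Norms

variable {M : Type*} [Field M] {τ : M ≃+* M} {r u u' : M}

lemma norm_of_fixed (hu : u ^ 2 = r) (h : τ u = u) : u * τ u = r := by
  rw [h, ← hu, pow_two]

lemma map_eq_neg_of_sq_fixed (hr : τ r = r) (hu : u ^ 2 = r) (h : τ u ≠ u) : τ u = -u := by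
  have : τ u ^ 2 = u ^ 2 := by rw [← map_pow, hu, hr]
  exact (sq_eq_sq_iff_eq_or_eq_neg.1 this).resolve_left h

lemma norm_of_not_fixed (hr : τ r = r) (hu' : u' ^ 2 = -r) (h : τ u' ≠ u') :
    u' * τ u' = r := by
  rw [map_eq_neg_of_sq_fixed (r := -r) (by rw [map_neg, hr]) hu' h, mul_neg, ← pow_two, hu',
    neg_neg]

/-- If `x² = -1` with `x` in the prime field, then `u = ± x u'` would be fixed along with `u'`. -/
lemma not_sq_neg_one {p : ℕ} [CharP M p] (hu : u ^ 2 = r) (hu' : u' ^ 2 = -r) (h : τ u ≠ u)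
    (h' : τ u' = u') : ¬ ∃ x : ℤ, x ^ 2 ≡ -1 [ZMOD p] := by
  rintro ⟨x, hx⟩
  have hx' : (x : M) ^ 2 = -1 := by
    simpa using (CharP.intCast_eq_intCast M p).2 hx
  have hsq : u ^ 2 = ((x : M) * u') ^ 2 := by rw [mul_pow, hx', hu', hu]; ring
  have hfix : τ ((x : M) * u') = (x : M) * u' := by rw [map_mul, map_intCast, h']
  rcases sq_eq_sq_iff_eq_or_eq_neg.1 hsq with h1 | h1
  · exact h (by rw [h1, hfix])
  · exact h (by rw [h1, map_neg, hfix])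

/-- Since `τ u = -u`, the numerator has norm `u'² - ν² u² = -r - (N - 1) r = -N r = η² r`. -/
lemma norm_of_isGoodInt {p : ℕ} [CharP M p] (hr : τ r = r) (hu : u ^ 2 = r) (hu' : u' ^ 2 = -r)
    (h : τ u ≠ u) (h' : τ u' = u') {N η ν : ℤ} (hN : IsGoodInt p N) (hη : η ^ 2 ≡ -N [ZMOD p])
    (hν : ν ^ 2 ≡ N - 1 [ZMOD p]) :
    (((ν : M) * u + u') / (η : M)) * τ (((ν : M) * u + u') / (η : M)) = r := by
  have hη' : (η : M) ^ 2 = -N := by simpa using (CharP.intCast_eq_intCast M p).2 hη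
  have hν' : (ν : M) ^ 2 = N - 1 := by simpa using (CharP.intCast_eq_intCast M p).2 hν
  have hN0 : (N : M) ≠ 0 := hN.cast_ne_zero
  rw [map_div₀, map_add, map_mul, map_intCast, map_intCast, h', map_eq_neg_of_sq_fixed hr hu h,
    div_mul_div_comm, ← pow_two (η : M), hη', div_eq_iff (neg_ne_zero.2 hN0)]
  linear_combination -(ν : M) ^ 2 * hu + hu' - r * hν'

end Norms

/-! ### Solving `v v̄ = R` class by class -/

section Classwise

variable {K L E : Type*} [Field K] [Fintype K] [Field L] [Algebra K L] [FiniteDimensional K L]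
  [Field E] [Algebra K E] {ζ : E} {S : Finset ℕ}

lemma coe_J_apply (hζ : IsPrimitiveRoot ζ (Module.finrank K L))
    (hS : IsRepSet (Fintype.card K) (Module.finrank K L) S)
    (hq : (Fintype.card K).Coprime (Module.finrank K L)) (y : Components (K := K) ζ S) (s t : S)
    {k : ℕ} (h : Module.finrank K L - s ≡ Fintype.card K ^ k * t [MOD Module.finrank K L]) :
    (J L ζ S y s : E) = (y t : E) ^ Fintype.card K ^ k := by
  obtain ⟨u, rfl⟩ := evalMap_surjective (L := L) hζ hS y
  rw [J_evalMap hζ hS hq, evalMap, coe_evalAt_conj hζ.pow_eq_one (hS.1 s s.2).le, evalMap,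
    coe_evalAt_of_modEq hζ.pow_eq_one h]

lemma J_J (hζ : IsPrimitiveRoot ζ (Module.finrank K L))
    (hS : IsRepSet (Fintype.card K) (Module.finrank K L) S)
    (hq : (Fintype.card K).Coprime (Module.finrank K L)) (y : Components (K := K) ζ S) :
    J L ζ S (J L ζ S y) = y := by
  obtain ⟨u, rfl⟩ := evalMap_surjective (L := L) hζ hS y
  rw [J_evalMap hζ hS hq, J_evalMap hζ hS hq, conj_conj]

lemma coe_evalAt_R_of_modEq (hζ : ζ ^ Module.finrank K L = 1) (α : L) {s t k : ℕ}
    (ht : t ≤ Module.finrank K L)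
    (h : s ≡ Fintype.card K ^ k * (Module.finrank K L - t) [MOD Module.finrank K L]) :
    (evalAt ζ (R (K := K) α) s : E) = (evalAt ζ (R (K := K) α) t : E) ^ Fintype.card K ^ k := by
  rw [coe_evalAt_of_modEq hζ h, ← coe_evalAt_conj hζ ht, conj_R]

/-- `∑ tr(α g(α)) = tr(α · tr(α)) = tr(α)²`. -/
lemma evalAt_R_zero (hζ : ζ ^ Module.finrank K L = 1) (α : L) {s : ℕ} (hs : s = 0) :
    evalAt ζ (R (K := K) α) s = algebraMap K K⟮ζ ^ s⟯ (Algebra.trace K L α) ^ 2 := by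
  subst hs
  apply Subtype.ext
  have := Module.finite_of_finite K (M := L)
  have h1 : (evalHom (ζ ^ 0) (pow_pow_finrank hζ 0) : MonoidAlgebra K Gal(L/K) →ₐ[K] E)
      (R (K := K) α) = algebraMap K E (∑ g : Gal(L/K), Algebra.trace K L (α * g α)) := by
    rw [R, map_sum, map_sum]
    refine Finset.sum_congr rfl fun g _ => ?_
    obtain ⟨i, rfl⟩ := exists_eq_frobenius_pow g
    rw [evalHom_single_pow, pow_zero, one_pow, mul_one]
  rw [coe_evalAt hζ, h1, ← map_sum, ← Finset.mul_sum, ← trace_eq_sum_automorphisms,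
    mul_comm, ← Algebra.smul_def, map_smul, smul_eq_mul, ← pow_two, map_pow]
  rfl

/-- Only the coordinate at `s` is prescribed, so this serves both the element supported at `0` and a
full family. -/
lemma zero_class (hζ : IsPrimitiveRoot ζ (Module.finrank K L))
    (hS : IsRepSet (Fintype.card K) (Module.finrank K L) S)
    (hq : (Fintype.card K).Coprime (Module.finrank K L)) (α : L) {s : S} (hs : (s : ℕ) = 0)
    {y : Components (K := K) ζ S}
    (hy : y s = algebraMap K K⟮ζ ^ (s : ℕ)⟯ (Algebra.trace K L α)) :
    y s * J L ζ S y s = evalAt ζ (R (K := K) α) (s : ℕ) := by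
  have h := coe_J_apply (L := L) hζ hS hq y s s (k := 0) (by simp [hs, Nat.ModEq])
  rw [pow_zero, pow_one] at h
  rw [Subtype.ext h, hy, evalAt_R_zero hζ.pow_eq_one α hs, pow_two]

/-- At a pair of opposite classes, `y ȳ = R` holds as soon as `y` is `R` at one class and `1` at
the other. -/
lemma pair_class (hζ : IsPrimitiveRoot ζ (Module.finrank K L))
    (hS : IsRepSet (Fintype.card K) (Module.finrank K L) S)
    (hq : (Fintype.card K).Coprime (Module.finrank K L)) (α : L) {s s' : S}
    (hss' : CycEquiv (Fintype.card K) (Module.finrank K L) s' (Module.finrank K L - s))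
    {y : Components (K := K) ζ S}
    (hy : (y s = evalAt ζ (R (K := K) α) (s : ℕ) ∧ y s' = 1) ∨
      (y s' = evalAt ζ (R (K := K) α) (s' : ℕ) ∧ y s = 1)) :
    y s * J L ζ S y s = evalAt ζ (R (K := K) α) (s : ℕ) := by
  obtain ⟨k, hk⟩ := hss'.symm hq
  have hJ := coe_J_apply (L := L) hζ hS hq y s s' hk
  apply Subtype.ext
  rw [IntermediateField.coe_mul, hJ]
  rcases hy with ⟨h1, h2⟩ | ⟨h1, h2⟩
  · simp [h1, h2]
  · rw [h1, h2, ← coe_evalAt_of_modEq hζ.pow_eq_one hk, ← coe_evalAt_conj hζ.pow_eq_one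
      (hS.1 s s.2).le, conj_R]
    simp

lemma J_single_apply_eq_zero (hζ : IsPrimitiveRoot ζ (Module.finrank K L))
    (hS : IsRepSet (Fintype.card K) (Module.finrank K L) S)
    (hq : (Fintype.card K).Coprime (Module.finrank K L)) {s t : S}
    (hst : ¬ CycEquiv (Fintype.card K) (Module.finrank K L) t (Module.finrank K L - s))
    (y : K⟮ζ ^ (s : ℕ)⟯) : J L ζ S (Pi.single s y) t = 0 := by
  obtain ⟨t', ht', h⟩ := hS.exists_cycEquiv Module.finrank_pos.ne' (Module.finrank K L - t)
  have hne : (⟨t', ht'⟩ : S) ≠ s := by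
    rintro rfl
    exact hst (h.sub_comm hq (hS.1 _ ht').le (hS.1 t t.2).le)
  obtain ⟨k, hk⟩ := h.symm hq
  apply Subtype.ext
  rw [coe_J_apply (L := L) hζ hS hq _ t ⟨t', ht'⟩ hk, Pi.single_eq_of_ne hne]
  simp [Fintype.card_ne_zero]

/-- As `-s` lies in the class of `s`, the coordinate of `J y` at `s` is a Frobenius power of `y s`
alone. -/
lemma exists_conjAt_eq (hζ : IsPrimitiveRoot ζ (Module.finrank K L))
    (hS : IsRepSet (Fintype.card K) (Module.finrank K L) S)
    (hq : (Fintype.card K).Coprime (Module.finrank K L)) {s : S}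
    (hs : CycEquiv (Fintype.card K) (Module.finrank K L) s (Module.finrank K L - s)) :
    ∃ τ : K⟮ζ ^ (s : ℕ)⟯ ≃ₐ[K] K⟮ζ ^ (s : ℕ)⟯, (∀ y, conjAt L ζ s y = τ y) ∧
      ∀ y : Components (K := K) ζ S, J L ζ S y s = τ (y s) := by
  have := finiteDimensional_component (K := K) (L := L) hζ.pow_eq_one s
  obtain ⟨k, hk⟩ := hs.symm hq
  have hJ : ∀ y : Components (K := K) ζ S, J L ζ S y s =
      (FiniteField.frobeniusAlgEquivOfAlgebraic K K⟮ζ ^ (s : ℕ)⟯ ^ k) (y s) := by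
    intro y
    apply Subtype.ext
    rw [coe_J_apply (L := L) hζ hS hq y s s hk, AlgEquiv.coe_pow,
      FiniteField.coe_frobeniusAlgEquivOfAlgebraic, pow_iterate]
    rfl
  exact ⟨_, fun y => by rw [conjAt, hJ, Pi.single_eq_same], hJ⟩

variable {s : S} {τ : K⟮ζ ^ (s : ℕ)⟯ ≃ₐ[K] K⟮ζ ^ (s : ℕ)⟯}

lemma J_single_of_selfReciprocal (hζ : IsPrimitiveRoot ζ (Module.finrank K L))
    (hS : IsRepSet (Fintype.card K) (Module.finrank K L) S)
    (hq : (Fintype.card K).Coprime (Module.finrank K L))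
    (hs : CycEquiv (Fintype.card K) (Module.finrank K L) s (Module.finrank K L - s))
    (hτ : ∀ y, conjAt L ζ s y = τ y) (y : K⟮ζ ^ (s : ℕ)⟯) :
    J L ζ S (Pi.single s y) = Pi.single s (τ y) := by
  ext t : 1
  by_cases ht : t = s
  · subst ht
    rw [Pi.single_eq_same, ← hτ]
    rfl
  · rw [Pi.single_eq_of_ne ht]
    refine J_single_apply_eq_zero hζ hS hq (fun h => ht (Subtype.ext ?_)) y
    exact hS.eq t.2 s.2 (h.trans (hs.symm hq))

lemma involution_of_selfReciprocal (hζ : IsPrimitiveRoot ζ (Module.finrank K L))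
    (hS : IsRepSet (Fintype.card K) (Module.finrank K L) S)
    (hq : (Fintype.card K).Coprime (Module.finrank K L))
    (hs : CycEquiv (Fintype.card K) (Module.finrank K L) s (Module.finrank K L - s))
    (hτ : ∀ y, conjAt L ζ s y = τ y) : τ * τ = 1 := by
  ext y : 1
  have h := J_J (L := L) hζ hS hq (Pi.single s y)
  rw [J_single_of_selfReciprocal hζ hS hq hs hτ, J_single_of_selfReciprocal hζ hS hq hs hτ] at h
  exact Pi.single_injective s h

lemma evalAt_conj_of_selfReciprocal (hζ : IsPrimitiveRoot ζ (Module.finrank K L))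
    (hS : IsRepSet (Fintype.card K) (Module.finrank K L) S)
    (hq : (Fintype.card K).Coprime (Module.finrank K L))
    (hτ : ∀ y : Components (K := K) ζ S, J L ζ S y s = τ (y s)) (u : MonoidAlgebra K Gal(L/K)) :
    τ (evalAt ζ u (s : ℕ)) = evalAt ζ (conj u) (s : ℕ) := by
  have h := hτ (evalMap ζ S u)
  rw [J_evalMap hζ hS hq] at h
  exact h.symm

lemma ne_one_of_selfReciprocal (hζ : IsPrimitiveRoot ζ (Module.finrank K L))
    (hS : IsRepSet (Fintype.card K) (Module.finrank K L) S)
    (hq : (Fintype.card K).Coprime (Module.finrank K L)) (hodd : Odd (Module.finrank K L))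
    (hs0 : (s : ℕ) ≠ 0) (hτ : ∀ y : Components (K := K) ζ S, J L ζ S y s = τ (y s)) : τ ≠ 1 := by
  rintro rfl
  -- Tested on the Frobenius, triviality of `τ` gives `ζ ^ s = ζ ^ (n - s)`, so `n = 2s`, which is
  -- not odd.
  have h := evalAt_conj_of_selfReciprocal hζ hS hq hτ
    (MonoidAlgebra.single (FiniteField.frobeniusAlgEquivOfAlgebraic K L ^ 1) 1)
  have hlt := hS.1 s s.2
  have h2 := congrArg (fun z : K⟮ζ ^ (s : ℕ)⟯ => (z : E)) h
  simp only [AlgEquiv.one_apply] at h2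
  rw [coe_evalAt_conj hζ.pow_eq_one hlt.le, coe_evalAt hζ.pow_eq_one, coe_evalAt hζ.pow_eq_one,
    evalHom_single_pow, evalHom_single_pow, map_one, one_mul, one_mul, pow_one, pow_one] at h2
  have h3 := hζ.pow_inj hlt (by omega) h2
  obtain ⟨m, hm⟩ := hodd
  omega

lemma isSelfReciprocalChoice_norm {p : ℕ} [CharP K p]
    (hζ : IsPrimitiveRoot ζ (Module.finrank K L))
    (hS : IsRepSet (Fintype.card K) (Module.finrank K L) S)
    (hq : (Fintype.card K).Coprime (Module.finrank K L)) {α : L}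
    (hs : CycEquiv (Fintype.card K) (Module.finrank K L) s (Module.finrank K L - s))
    {y : Components (K := K) ζ S} (hy : IsSelfReciprocalChoice p α ζ s (y s)) :
    y s * J L ζ S y s = evalAt ζ (R (K := K) α) (s : ℕ) := by
  obtain ⟨τ, hτ, hτJ⟩ := exists_conjAt_eq hζ hS hq hs
  have : CharP K⟮ζ ^ (s : ℕ)⟯ p := charP_of_injective_algebraMap
    (algebraMap K K⟮ζ ^ (s : ℕ)⟯).injective p
  have hr := evalAt_conj_of_selfReciprocal hζ hS hq hτJ (R α)
  rw [conj_R] at hr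
  rw [hτJ]
  obtain ⟨u, u', hu, hu', h⟩ := hy
  simp only [hτ] at h
  rcases h with ⟨h, h1⟩ | ⟨h, h1⟩ | ⟨h, h', N, η, ν, hN, hη, hν, h1⟩
  · rw [h1]
    exact norm_of_fixed (τ := (τ : K⟮ζ ^ (s : ℕ)⟯ ≃+* K⟮ζ ^ (s : ℕ)⟯)) hu h
  · rw [h1]
    exact norm_of_not_fixed (τ := (τ : K⟮ζ ^ (s : ℕ)⟯ ≃+* K⟮ζ ^ (s : ℕ)⟯)) hr hu' h
  · rw [h1]
    exact norm_of_isGoodInt (τ := (τ : K⟮ζ ^ (s : ℕ)⟯ ≃+* K⟮ζ ^ (s : ℕ)⟯)) hr hu hu' h h' hN hη hν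

lemma isSquare_evalAt_R (hζ : IsPrimitiveRoot ζ (Module.finrank K L))
    (hS : IsRepSet (Fintype.card K) (Module.finrank K L) S)
    (hq : (Fintype.card K).Coprime (Module.finrank K L)) (hodd : Odd (Module.finrank K L))
    (hs0 : (s : ℕ) ≠ 0) (α : L)
    (hs : CycEquiv (Fintype.card K) (Module.finrank K L) s (Module.finrank K L - s)) :
    IsSquare (evalAt ζ (R (K := K) α) (s : ℕ)) ∧ IsSquare (-evalAt ζ (R (K := K) α) (s : ℕ)) := by
  obtain ⟨τ, hτ, hτJ⟩ := exists_conjAt_eq hζ hS hq hs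
  have := finiteDimensional_component (K := K) (L := L) hζ.pow_eq_one s
  have : Finite K⟮ζ ^ (s : ℕ)⟯ := Module.finite_of_finite K
  have hr := evalAt_conj_of_selfReciprocal hζ hS hq hτJ (R α)
  rw [conj_R] at hr
  have h1 := ne_one_of_selfReciprocal hζ hS hq hodd hs0 hτJ
  have h2 := involution_of_selfReciprocal hζ hS hq hs hτ
  exact ⟨isSquare_of_involution h1 h2 hr, isSquare_of_involution h1 h2 (by rw [map_neg, hr])⟩

lemma exists_isSelfReciprocalChoice {p : ℕ} [CharP K p]
    (hζ : IsPrimitiveRoot ζ (Module.finrank K L))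
    (hS : IsRepSet (Fintype.card K) (Module.finrank K L) S)
    (hq : (Fintype.card K).Coprime (Module.finrank K L)) (hodd : Odd (Module.finrank K L))
    (hs0 : (s : ℕ) ≠ 0) (α : L)
    (hs : CycEquiv (Fintype.card K) (Module.finrank K L) s (Module.finrank K L - s)) :
    ∃ y : K⟮ζ ^ (s : ℕ)⟯, IsSelfReciprocalChoice p α ζ s y := by
  obtain ⟨τ, hτ, hτJ⟩ := exists_conjAt_eq hζ hS hq hs
  have : CharP K⟮ζ ^ (s : ℕ)⟯ p := charP_of_injective_algebraMap
    (algebraMap K K⟮ζ ^ (s : ℕ)⟯).injective p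
  have hp : p.Prime := CharP.char_is_prime K p
  obtain ⟨⟨u, hu⟩, ⟨u', hu'⟩⟩ := isSquare_evalAt_R hζ hS hq hodd hs0 α hs
  rw [← pow_two] at hu hu'
  by_cases h : conjAt L ζ s u = u
  · exact ⟨u, u, u', hu.symm, hu'.symm, Or.inl ⟨h, rfl⟩⟩
  by_cases h' : conjAt L ζ s u' = u'
  · have hsq := not_sq_neg_one (p := p) (τ := (τ : K⟮ζ ^ (s : ℕ)⟯ ≃+* K⟮ζ ^ (s : ℕ)⟯)) hu.symm
      hu'.symm (by rwa [hτ] at h) (by rwa [hτ] at h')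
    obtain ⟨N, hN⟩ := exists_isGoodInt hp hsq
    obtain ⟨ν, hν⟩ := hN.exists_sq hp hsq
    obtain ⟨η, -, hη⟩ := hN.1
    exact ⟨_, u, u', hu.symm, hu'.symm, Or.inr (Or.inr ⟨h, h', N, η, ν, hN, hη, hν, rfl⟩)⟩
  · exact ⟨u', u, u', hu.symm, hu'.symm, Or.inr (Or.inl ⟨h', rfl⟩)⟩

lemma exists_followsRecipe {p : ℕ} [CharP K p]
    (hζ : IsPrimitiveRoot ζ (Module.finrank K L))
    (hS : IsRepSet (Fintype.card K) (Module.finrank K L) S)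
    (hq : (Fintype.card K).Coprime (Module.finrank K L)) (hodd : Odd (Module.finrank K L))
    (α : L) : ∃ v : Components (K := K) ζ S, FollowsRecipe p α ζ (Module.finrank K L) v := by
  classical
  -- In each pair the smaller representative receives `R_s` and the larger `1`. The class of `0`
  -- counts as self-reciprocal, so the pair clause is void there.
  have hex : ∀ s : S, ∃ y : K⟮ζ ^ (s : ℕ)⟯,
      ((s : ℕ) = 0 → y = algebraMap K K⟮ζ ^ (s : ℕ)⟯ (Algebra.trace K L α)) ∧
      (¬ CycEquiv (Fintype.card K) (Module.finrank K L) s (Module.finrank K L - s) →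
        y = if ∃ t ∈ S, (s : ℕ) < t ∧
          CycEquiv (Fintype.card K) (Module.finrank K L) t (Module.finrank K L - s)
        then evalAt ζ (R (K := K) α) (s : ℕ) else 1) ∧
      ((s : ℕ) ≠ 0 → CycEquiv (Fintype.card K) (Module.finrank K L) s (Module.finrank K L - s) →
        IsSelfReciprocalChoice p α ζ s y) := by
    intro s
    by_cases h0 : (s : ℕ) = 0
    · refine ⟨_, fun _ => rfl, fun h => (h ?_).elim, fun h => (h h0).elim⟩
      exact ⟨0, by simp [h0, Nat.ModEq]⟩
    by_cases hs : CycEquiv (Fintype.card K) (Module.finrank K L) s (Module.finrank K L - s)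
    · obtain ⟨y, hy⟩ := exists_isSelfReciprocalChoice (p := p) hζ hS hq hodd h0 α hs
      exact ⟨y, fun h => (h0 h).elim, fun h => (h hs).elim, fun _ _ => hy⟩
    · exact ⟨_, fun h => (h0 h).elim, fun _ => rfl, fun _ h => (hs h).elim⟩
  choose v hv0 hv1 hv2 using hex
  refine ⟨v, hv0, fun s s' hs hss' => ?_, hv2⟩
  have hle : ∀ t : S, (t : ℕ) ≤ Module.finrank K L := fun t => (hS.1 t t.2).le
  have hs' := not_cycEquiv_sub hq (hle s) (hle s') hs hss'
  have hs's := hss'.sub_comm hq (hle s') (hle s)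
  have hne : (s : ℕ) ≠ s' := fun h => hs (by rw [← h] at hss'; exact hss')
  have huniq : ∀ {a b : S} {t : ℕ}, t ∈ S →
      CycEquiv (Fintype.card K) (Module.finrank K L) b (Module.finrank K L - a) →
      CycEquiv (Fintype.card K) (Module.finrank K L) t (Module.finrank K L - a) → t = b :=
    fun ht hb h => hS.eq ht (Subtype.prop _) (h.trans (hb.symm hq))
  rcases lt_or_gt_of_ne hne with hlt | hlt
  · left
    rw [hv1 s hs, hv1 s' hs', if_pos ⟨s', s'.2, hlt, hss'⟩, if_neg]
    · exact ⟨rfl, rfl⟩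
    · rintro ⟨t, ht, htlt, h⟩
      have := huniq ht hs's h
      omega
  · right
    rw [hv1 s hs, hv1 s' hs', if_pos ⟨s, s.2, hlt, hs's⟩, if_neg]
    · exact ⟨rfl, rfl⟩
    · rintro ⟨t, ht, htlt, h⟩
      have := huniq ht hss' h
      omega

lemma FollowsRecipe.mul_J {p : ℕ} [CharP K p]
    (hζ : IsPrimitiveRoot ζ (Module.finrank K L))
    (hS : IsRepSet (Fintype.card K) (Module.finrank K L) S)
    (hq : (Fintype.card K).Coprime (Module.finrank K L)) {α : L} {v : Components (K := K) ζ S}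
    (hv : FollowsRecipe p α ζ (Module.finrank K L) v) :
    v * J L ζ S v = evalMap ζ S (R (K := K) α) := by
  ext s : 1
  rw [Pi.mul_apply]
  by_cases h0 : (s : ℕ) = 0
  · exact zero_class hζ hS hq α h0 (hv.zero s h0)
  by_cases hs : CycEquiv (Fintype.card K) (Module.finrank K L) s (Module.finrank K L - s)
  · exact isSelfReciprocalChoice_norm hζ hS hq hs (hv.selfReciprocal s h0 hs)
  · obtain ⟨s', hs', h⟩ := hS.exists_cycEquiv Module.finrank_pos.ne' (Module.finrank K L - s)
    exact pair_class hζ hS hq α (s' := ⟨s', hs'⟩) h (hv.pair s ⟨s', hs'⟩ hs h)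

lemma FollowsRecipe.mul_conj {p : ℕ} [CharP K p]
    (hζ : IsPrimitiveRoot ζ (Module.finrank K L))
    (hS : IsRepSet (Fintype.card K) (Module.finrank K L) S)
    (hq : (Fintype.card K).Coprime (Module.finrank K L)) {α : L} {v : Components (K := K) ζ S}
    (hv : FollowsRecipe p α ζ (Module.finrank K L) v) {w : MonoidAlgebra K Gal(L/K)}
    (hw : evalMap ζ S w = v) : w * conj w = R α := by
  apply (evalEquiv hζ hS hq).injective
  rw [map_mul, evalEquiv_apply, evalEquiv_apply, evalEquiv_apply, ← J_evalMap hζ hS hq, hw,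
    hv.mul_J hζ hS hq]

end Classwise

lemma exists_isPrimitiveRoot_algebraicClosure {K : Type*} [Field K] (p : ℕ) [CharP K p] {n : ℕ}
    (h : n.Coprime p) (hn : n ≠ 0) : ∃ ζ : AlgebraicClosure K, IsPrimitiveRoot ζ n := by
  have : NeZero (n : AlgebraicClosure K) := by
    have : NeZero n := ⟨hn⟩
    have : CharP (AlgebraicClosure K) p := charP_of_injective_algebraMap
      (algebraMap K (AlgebraicClosure K)).injective p
    refine ⟨fun h0 => ?_⟩
    rw [CharP.cast_eq_zero_iff (AlgebraicClosure K) p] at h0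
    have h1 : p = 1 := Nat.eq_one_of_dvd_coprimes h h0 dvd_rfl
    exact CharP.char_ne_one K p h1
  exact HasEnoughRootsOfUnity.exists_primitiveRoot _ n

end SelfDualNormal

/-! ### The main theorem -/

theorem mainTheorem7 {K L : Type*} [Field K] [Fintype K] [Field L] [Algebra K L]
    [FiniteDimensional K L] (p n : ℕ) [CharP K p] (hn : Module.finrank K L = n)
    (hodd : Odd n) (hcop : n.Coprime p) :
    (∀ α : L, IsNormalGenerator K L α →
      -- every extension `E` of `K` with a primitive `n`-th root of unity `ζ`
      (∀ (E : Type*) [Field E] [Algebra K E] (ζ : E), IsPrimitiveRoot ζ n →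
        ∀ S : Finset ℕ, IsRepSet (Fintype.card K) n S →
        -- the decomposition is an isomorphism of algebras
        (∃ Ψ : MonoidAlgebra K Gal(L/K) ≃ₐ[K] Components (K := K) ζ S,
          ∀ u, Ψ u = evalMap ζ S u) ∧
        -- the class of `0`
        (∀ s : S, (s : ℕ) = 0 →
          (Pi.single s (algebraMap K K⟮ζ ^ (s : ℕ)⟯ (Algebra.trace K L α)) :
              Components (K := K) ζ S) *
            J L ζ S
              (Pi.single s (algebraMap K K⟮ζ ^ (s : ℕ)⟯ (Algebra.trace K L α))) =
          Pi.single s (evalAt ζ (R (K := K) α) s)) ∧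
        -- pairs of distinct opposite classes
        (∀ s s' : S, ¬ CycEquiv (Fintype.card K) n s (n - s) →
          CycEquiv (Fintype.card K) n s' (n - s) →
          ((s' : ℕ) = n - s →
            (evalAt ζ (R (K := K) α) s' : E) =
              evalAt ζ (R (K := K) α) s) ∧
          (∀ k : ℕ, (s' : ℕ) ≡ Fintype.card K ^ k * (n - s) [MOD n] →
            (evalAt ζ (R (K := K) α) s' : E) =
              (evalAt ζ (R (K := K) α) s : E) ^
                (Fintype.card K ^ k)) ∧
          (Pi.single s (evalAt ζ (R (K := K) α) s) +
              Pi.single s' 1 : Components (K := K) ζ S) *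
            J L ζ S
              (Pi.single s (evalAt ζ (R (K := K) α) s) +
                Pi.single s' 1) =
          Pi.single s (evalAt ζ (R (K := K) α) s) +
            Pi.single s' (evalAt ζ (R (K := K) α) s')) ∧
        -- self-reciprocal classes other than `0`
        (∀ s : S, (s : ℕ) ≠ 0 → CycEquiv (Fintype.card K) n s (n - s) →
          -- `K(ζ ^ s)` is stable under `J`, which induces an automorphism of it
          (∃ τ : K⟮ζ ^ (s : ℕ)⟯ ≃ₐ[K] K⟮ζ ^ (s : ℕ)⟯,
            (∀ y, J L ζ S (Pi.single s y) = Pi.single s (τ y)) ∧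
            (∀ y, conjAt L ζ s y = τ y) ∧
            (∀ y, y ∈ IntermediateField.fixedField (Subgroup.zpowers τ) ↔
              conjAt L ζ s y = y)) ∧
          IsSquare (evalAt ζ (R (K := K) α) s) ∧
          IsSquare (-evalAt ζ (R (K := K) α) s) ∧
          (∀ u u' : K⟮ζ ^ (s : ℕ)⟯,
            u ^ 2 = evalAt ζ (R (K := K) α) s →
            u' ^ 2 = -evalAt ζ (R (K := K) α) s →
            (conjAt L ζ s u = u →
              u * conjAt L ζ s u =
                evalAt ζ (R (K := K) α) s) ∧
            (conjAt L ζ s u' ≠ u' →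
              u' * conjAt L ζ s u' =
                evalAt ζ (R (K := K) α) s) ∧
            (conjAt L ζ s u ≠ u → conjAt L ζ s u' = u' →
              (∃ N : ℤ, IsGoodInt p N) ∧
              ∀ N : ℤ, IsGoodInt p N →
                (∃ ν : ℤ, ν ^ 2 ≡ N - 1 [ZMOD p]) ∧
                ∀ η ν : ℤ, η ^ 2 ≡ -N [ZMOD p] → ν ^ 2 ≡ N - 1 [ZMOD p] →
                  (((ν : K⟮ζ ^ (s : ℕ)⟯) * u + u') / (η : K⟮ζ ^ (s : ℕ)⟯)) *
                    conjAt L ζ s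
                      (((ν : K⟮ζ ^ (s : ℕ)⟯) * u + u') / (η : K⟮ζ ^ (s : ℕ)⟯)) =
                  evalAt ζ (R (K := K) α) s))) ∧
        -- the class-wise solutions lift to solutions in `K[G]`
        (∃ v : Components (K := K) ζ S,
          FollowsRecipe p α ζ n v) ∧
        (∀ v : Components (K := K) ζ S,
          FollowsRecipe p α ζ n v →
          (∃! w : MonoidAlgebra K Gal(L/K), evalMap ζ S w = v) ∧
          ∀ w : MonoidAlgebra K Gal(L/K), evalMap ζ S w = v →
            w * conj w = R α ∧
            ∃ w' : MonoidAlgebra K Gal(L/K), w * w' = 1 ∧ w' * w = 1 ∧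
              IsSelfDualNormalGenerator K L (act w' α))) ∧
      -- solvability in `K[G]`
      (∃ v : MonoidAlgebra K Gal(L/K), v * conj v = R α)) ∧
    -- existence of a self-dual normal basis
    (∃ β : L, IsSelfDualNormalGenerator K L β) := by
  subst hn
  have hp : p.Prime := CharP.char_is_prime K p
  have hq : (Fintype.card K).Coprime (Module.finrank K L) := by
    obtain ⟨f, -, hf⟩ := FiniteField.card K p
    rw [hf]
    exact (hcop.pow_right _).symm
  have : Finite L := Module.finite_of_finite K
  have hsol : ∀ α : L, ∃ v : MonoidAlgebra K Gal(L/K), v * conj v = R α := by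
    intro α
    obtain ⟨ζ, hζ⟩ := exists_isPrimitiveRoot_algebraicClosure (K := K) p hcop
      Module.finrank_pos.ne'
    obtain ⟨S, hS⟩ := exists_isRepSet hq
    obtain ⟨v, hv⟩ := exists_followsRecipe (p := p) hζ hS hq hodd α
    obtain ⟨w, hw⟩ := evalMap_surjective (L := L) hζ hS v
    exact ⟨w, hv.mul_conj hζ hS hq hw⟩
  have hsd : ∀ {α : L}, IsNormalGenerator K L α → ∀ {w : MonoidAlgebra K Gal(L/K)},
      w * conj w = R α → ∃ w' : MonoidAlgebra K Gal(L/K), w * w' = 1 ∧ w' * w = 1 ∧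
        IsSelfDualNormalGenerator K L (act w' α) := by
    intro α hα w hw
    obtain ⟨w', h1, h2⟩ := hα.exists_inverse groupAlgebra_mul_comm hw
    exact ⟨w', h1, h2, isSelfDualNormalGenerator_act groupAlgebra_mul_comm hw h1⟩
  refine ⟨fun α hα => ⟨fun E _ _ ζ hζ S hS => ⟨⟨evalEquiv hζ hS hq, evalEquiv_apply hζ hS hq⟩,
    fun s hs => ?_, fun s s' hs hss' => ?_, fun s hs0 hs => ?_,
    exists_followsRecipe hζ hS hq hodd α, fun v hv => ⟨?_, fun w hw => ?_⟩⟩, hsol α⟩, ?_⟩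
  · ext t : 1
    by_cases ht : t = s
    · subst ht
      rw [Pi.mul_apply, zero_class hζ hS hq α hs (Pi.single_eq_same _ _), Pi.single_eq_same]
    · rw [Pi.mul_apply, Pi.single_eq_of_ne ht, Pi.single_eq_of_ne ht, zero_mul]
  · have hle : ∀ t : S, (t : ℕ) ≤ Module.finrank K L := fun t => (hS.1 t t.2).le
    refine ⟨fun h => ?_, fun k hk => coe_evalAt_R_of_modEq hζ.pow_eq_one α (hle s) hk, ?_⟩
    · rw [coe_evalAt_R_of_modEq (s := s') (t := s) (k := 0) hζ.pow_eq_one α (hle s)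
        (by simp [h, Nat.ModEq]), pow_zero, pow_one]
    have hne : s ≠ s' := by
      rintro rfl
      exact hs hss'
    ext t : 1
    by_cases ht : t = s
    · subst ht
      rw [Pi.mul_apply, pair_class hζ hS hq α hss' (Or.inl ⟨?_, ?_⟩)]
      · simp [hne]
      · simp [hne]
      · simp [hne.symm]
    by_cases ht' : t = s'
    · subst ht'
      -- At the opposite class the same argument applies with the roles of `s` and `s'` exchanged.
      rw [Pi.mul_apply, pair_class hζ hS hq α (hss'.sub_comm hq (hle t) (hle s))
        (Or.inr ⟨?_, ?_⟩)]
      · simp [hne.symm]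
      · simp [hne]
      · simp [hne.symm]
    · simp [ht, ht']
  · obtain ⟨τ, hτ, hτJ⟩ := exists_conjAt_eq hζ hS hq hs
    have : CharP K⟮ζ ^ (s : ℕ)⟯ p := charP_of_injective_algebraMap
      (algebraMap K K⟮ζ ^ (s : ℕ)⟯).injective p
    have hr := evalAt_conj_of_selfReciprocal hζ hS hq hτJ (R α)
    rw [conj_R] at hr
    obtain ⟨h1, h2⟩ := isSquare_evalAt_R hζ hS hq hodd hs0 α hs
    refine ⟨⟨τ, J_single_of_selfReciprocal hζ hS hq hs hτ, hτ, fun y => ?_⟩, h1, h2,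
      fun u u' hu hu' => ?_⟩
    · rw [hτ]
      exact mem_fixedField_zpowers τ y
    · simp only [hτ]
      let σ : K⟮ζ ^ (s : ℕ)⟯ ≃+* K⟮ζ ^ (s : ℕ)⟯ := τ
      refine ⟨fun h => norm_of_fixed (τ := σ) hu h, fun h => norm_of_not_fixed (τ := σ) hr hu' h,
        fun h h' => ?_⟩
      have hsq := not_sq_neg_one (p := p) (τ := σ) hu hu' h h'
      exact ⟨exists_isGoodInt hp hsq, fun N hN => ⟨hN.exists_sq hp hsq, fun η ν hη hν =>
        norm_of_isGoodInt (τ := σ) hr hu hu' h h' hN hη hν⟩⟩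
  · obtain ⟨w, hw⟩ := evalMap_surjective (L := L) hζ hS v
    exact ⟨w, hw, fun w' hw' => evalMap_injective hζ hS hq (hw'.trans hw.symm)⟩
  · have hw' := hv.mul_conj hζ hS hq hw
    exact ⟨hw', hsd hα hw'⟩
  · obtain ⟨α, hα⟩ := exists_isNormalGenerator (K := K) (L := L)
    obtain ⟨w, hw⟩ := hsol α
    obtain ⟨w', -, -, h⟩ := hsd hα hw
    exact ⟨_, h⟩
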